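/- Let $n$ be a positive integer, $X=\{1,\dots,n\}$, and let $X'=\{1',\dots,n'\}$ be a disjoint copy of $X$. A *generalised line* is a subset of $X\cup X'$ that meets both $X$ and $X'$; a *point* is a one-element subset. Let $\mathcal{PI}^*_n$ be the set of all partitions of $X\cup X'$ into points and generalised lines. The product of $\alpha,\beta\in\mathcal{PI}^*_n$ is defined as follows. Add a new element $\bar x$ to $X$ and $\bar x'$ to $X'$, and let $\bar\alpha$ be the partition of $(X\cup\{\bar x\})\cup(X\cup\{\bar x\})'$ whose blocks are the generalised lines of $\alpha$ and one further block consisting of $\bar x$, $\bar x'$ and all points of $\alpha$. Let $\bar\alpha\bar\beta$ be the usual product of partition diagrams: place $\bar\alpha$ above $\bar\beta$, identify each bottom vertex of $\bar\alpha$ with the corresponding top vertex of $\bar\beta$, and restrict the resulting connected components to the top vertices of $\bar\alpha$ and the bottom vertices of $\bar\beta$. Then $\alpha\beta$ is the unique element of $\mathcal{PI}^*_n$ with $\overline{\alpha\beta}=\bar\alpha\bar\beta$. With this product $\mathcal{PI}^*_n$ is an inverse semigroup, in which $\alpha^{-1}$ is obtained from $\alpha$ by exchanging $t$ and $t'$ for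 all $t\in X$. The symmetric group $\mathcal S_n$ is regarded as a subset of $\mathcal{PI}^*_n$ by identifying a permutation $g$ with the partition with blocks $\{t,g(t)'\}$, $t\in X$. For $n\ge 2$ let $\gamma_{1,2}\in\mathcal{PI}^*_n$ be the partition with blocks $\{1,2,1'\}$, $\{2'\}$ and $\{t,t'\}$ for $t\in X\setminus\{1,2\}$. **Theorem.** Let $n\ge 3$. 1. $\mathcal{PI}^*_n$ is generated as an inverse semigroup by $\mathcal S_n$ and $\gamma_{1,2}$; that is, the only subset of $\mathcal{PI}^*_n$ that contains $\mathcal S_n\cup\{\gamma_{1,2}\}$ and is closed under products and inverses is $\mathcal{PI}^*_n$ itself. 2. For every $u\in\mathcal{PI}^*_n\setminus\mathcal S_n$, $\mathcal{PI}^*_n$ is generated as an inverse semigroup by $\mathcal S_n$ and $u$ if and only if $u\in\mathcal S_n\{\gamma_{1,2},\gamma_{1,2}^{-1}\}\mathcal S_n$. -/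

import Mathlib

open scoped Pointwise

/- A partition of `X ∪ X'` is given as an equivalence relation on `X ⊕ X`; the blocks are the
equivalence classes, `Sum.inl x` is the vertex `x`, and `Sum.inr x` is the vertex `x'`. -/

namespace PartitionDiagram

/-- A block that consists of one vertex. -/
def IsPoint {X : Type*} (A : Set (X ⊕ X)) : Prop := ∃ a, A = {a}

/-- A block that meets both `X` and `X'`. -/
def IsGenLine {X : Type*} (A : Set (X ⊕ X)) : Prop :=
  (∃ x, Sum.inl x ∈ A) ∧ ∃ y, Sum.inr y ∈ A

/-- The vertices of the upper diagram inside the three-layer diagram (top, middle, bottom). -/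
def upper {X : Type*} : X ⊕ X → X ⊕ (X ⊕ X) := Sum.map id Sum.inl

/-- The vertices of the lower diagram inside the three-layer diagram. -/
def lower {X : Type*} : X ⊕ X → X ⊕ (X ⊕ X) := Sum.inr

/-- The top and bottom vertices inside the three-layer diagram. -/
def outer {X : Type*} : X ⊕ X → X ⊕ (X ⊕ X) := Sum.map id Sum.inr

/-- The natural product of partitions: stack `α` on top of `β`, identify the bottom vertices of
`α` with the top vertices of `β`, take connected components, and restrict these to the top
vertices of `α` and the bottom vertices of `β`. -/
def natMul {X : Type*} (α β : Setoid (X ⊕ X)) : Setoid (X ⊕ X) :=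
  (α.map upper ⊔ β.map lower).comap outer

end PartitionDiagram

open PartitionDiagram in
/-- The dual symmetric inverse monoid `I*_X`: all blocks are generalised lines. -/
@[ext]
structure IStar (X : Type*) where
  rel : Setoid (X ⊕ X)
  block : ∀ A ∈ rel.classes, IsGenLine A

open PartitionDiagram in
/-- `PI*_X`: all blocks are points or generalised lines. -/
@[ext]
structure PIStar (X : Type*) where
  rel : Setoid (X ⊕ X)
  block : ∀ A ∈ rel.classes, IsPoint A ∨ IsGenLine A

namespace IStar

open PartitionDiagram

variable {X : Type*}

theorem exists_inl (α : IStar X) (a : X ⊕ X) : ∃ x, α.rel (Sum.inl x) a :=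
  (α.block _ ⟨a, rfl⟩).1

theorem exists_inr (α : IStar X) (a : X ⊕ X) : ∃ y, α.rel (Sum.inr y) a :=
  (α.block _ ⟨a, rfl⟩).2

theorem upper_rel {α β : Setoid (X ⊕ X)} {a b : X ⊕ X} (h : α a b) :
    (α.map upper ⊔ β.map lower) (upper a) (upper b) :=
  (le_sup_left : α.map upper ≤ α.map upper ⊔ β.map lower)
    (Relation.EqvGen.rel _ _ ⟨a, b, h, rfl, rfl⟩)

theorem lower_rel {α β : Setoid (X ⊕ X)} {a b : X ⊕ X} (h : β a b) :
    (α.map upper ⊔ β.map lower) (lower a) (lower b) :=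
  (le_sup_right : β.map lower ≤ α.map upper ⊔ β.map lower)
    (Relation.EqvGen.rel _ _ ⟨a, b, h, rfl, rfl⟩)

/-- `I*_X` is closed under the natural product. -/
instance : Mul (IStar X) where
  mul α β :=
    { rel := natMul α.rel β.rel
      block := by
        rintro _ ⟨a, rfl⟩
        rcases a with x | y
        · obtain ⟨m, hm⟩ := α.exists_inr (Sum.inl x)
          obtain ⟨y, hy⟩ := β.exists_inr (Sum.inl m)
          exact ⟨⟨x, Setoid.refl' (natMul α.rel β.rel) _⟩, y, Setoid.trans' _ (lower_rel hy) (upper_rel hm)⟩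
        · obtain ⟨m, hm⟩ := β.exists_inl (Sum.inr y)
          obtain ⟨x, hx⟩ := α.exists_inl (Sum.inr m)
          exact ⟨⟨x, Setoid.trans' _ (upper_rel hx) (lower_rel hm)⟩, y, Setoid.refl' (natMul α.rel β.rel) _⟩ }

theorem mul_rel (α β : IStar X) : (α * β).rel = natMul α.rel β.rel := rfl

end IStar

namespace PIStar

open PartitionDiagram

variable {X : Type*}

/-- The inclusion of the vertices over `X` into the vertices over `X ∪ {x̄}`; here `X ∪ {x̄}` is
`Option X` and `x̄` is `none`. -/
def emb : X ⊕ X → Option X ⊕ Option X := Sum.map some some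

theorem emb_injective : Function.Injective (emb : X ⊕ X → _) :=
  Function.Injective.sumMap (Option.some_injective X) (Option.some_injective X)

/-- The extra block of `ᾱ`: it consists of `x̄`, `x̄'` and all points of `α`. -/
def extra (α : PIStar X) : Set (Option X ⊕ Option X) :=
  {Sum.inl none, Sum.inr none} ∪ emb '' {a | {a} ∈ α.rel.classes}

theorem eq_of_point {α : PIStar X} {a b : X ⊕ X} (h : {a} ∈ α.rel.classes)
    (hab : α.rel a b) : a = b := by
  obtain ⟨c, hc⟩ := h
  have ha : α.rel a c := (Set.ext_iff.1 hc a).1 rfl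
  exact ((Set.ext_iff.1 hc b).2 (Setoid.trans' _ (Setoid.symm' _ hab) ha)).symm

theorem mem_extra_of_rel {α : PIStar X} {a b : X ⊕ X} (h : emb a ∈ α.extra)
    (hab : α.rel a b) : a = b := by
  rcases h with h | ⟨c, hc, hca⟩
  · rcases a with a | a <;> simp [emb] at h
  · exact eq_of_point (emb_injective hca ▸ hc) hab

/-- The element `ᾱ` of `I*_{X ∪ {x̄}}`: its blocks are the generalised lines of `α` and the
extra block. -/
def bar (α : PIStar X) : IStar (Option X) where
  rel :=
    { r := fun a b => (a ∈ α.extra ∧ b ∈ α.extra) ∨ ∃ u v, emb u = a ∧ emb v = b ∧ α.rel u v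
      iseqv := by
        refine ⟨fun a => ?_, ?_, ?_⟩
        · rcases a with (_ | x) | (_ | x)
          · exact Or.inl ⟨Or.inl (Or.inl rfl), Or.inl (Or.inl rfl)⟩
          · exact Or.inr ⟨Sum.inl x, Sum.inl x, rfl, rfl, Setoid.refl' _ _⟩
          · exact Or.inl ⟨Or.inl (Or.inr rfl), Or.inl (Or.inr rfl)⟩
          · exact Or.inr ⟨Sum.inr x, Sum.inr x, rfl, rfl, Setoid.refl' _ _⟩
        · rintro a b (⟨h, k⟩ | ⟨u, v, hu, hv, h⟩)
          · exact Or.inl ⟨k, h⟩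
          · exact Or.inr ⟨v, u, hv, hu, Setoid.symm' _ h⟩
        · rintro a b c (⟨h, k⟩ | ⟨u, v, rfl, rfl, h⟩) (⟨h₂, k₂⟩ | ⟨u₂, v₂, hu₂, rfl, h₂⟩)
          · exact Or.inl ⟨h, k₂⟩
          · subst hu₂
            obtain rfl := mem_extra_of_rel k h₂
            exact Or.inl ⟨h, k⟩
          · obtain rfl := mem_extra_of_rel h₂ (Setoid.symm' _ h)
            exact Or.inl ⟨h₂, k₂⟩
          · obtain rfl := emb_injective hu₂
            exact Or.inr ⟨u, v₂, rfl, rfl, Setoid.trans' _ h h₂⟩ }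
  block := by
    rintro _ ⟨a, rfl⟩
    have key : a ∈ α.extra ∨ ∃ u, emb u = a := by
      rcases a with (_ | x) | (_ | x)
      · exact Or.inl (Or.inl (Or.inl rfl))
      · exact Or.inr ⟨Sum.inl x, rfl⟩
      · exact Or.inl (Or.inl (Or.inr rfl))
      · exact Or.inr ⟨Sum.inr x, rfl⟩
    have hex : a ∈ α.extra → IsGenLine {x | (x ∈ α.extra ∧ a ∈ α.extra) ∨
        ∃ u v, emb u = x ∧ emb v = a ∧ α.rel u v} := fun h =>
      ⟨⟨none, Or.inl ⟨Or.inl (Or.inl rfl), h⟩⟩, ⟨none, Or.inl ⟨Or.inl (Or.inr rfl), h⟩⟩⟩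
    rcases key with h | ⟨u, rfl⟩
    · exact hex h
    · rcases α.block _ ⟨u, rfl⟩ with ⟨b, hb⟩ | ⟨⟨x, hx⟩, y, hy⟩
      · have : u = b := (Set.ext_iff.1 hb u).1 (Setoid.refl' _ _)
        subst this
        exact hex (Or.inr ⟨u, ⟨u, hb.symm⟩, rfl⟩)
      · exact ⟨⟨some x, Or.inr ⟨Sum.inl x, u, rfl, rfl, hx⟩⟩,
          some y, Or.inr ⟨Sum.inr y, u, rfl, rfl, hy⟩⟩

theorem bar_none (α : PIStar X) : α.bar.rel (Sum.inl none) (Sum.inr none) :=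
  Or.inl ⟨Or.inl (Or.inl rfl), Or.inl (Or.inr rfl)⟩

/-- The inverse of `α ↦ ᾱ`, on the elements `γ` of `I*_{X ∪ {x̄}}` with `x̄ ≡ x̄'`: the blocks of
`γ` that do not contain `x̄` are kept, and the other vertices become points. -/
def unbar (γ : IStar (Option X)) (hγ : γ.rel (Sum.inl none) (Sum.inr none)) : PIStar X where
  rel :=
    { r := fun a b => a = b ∨ (γ.rel (emb a) (emb b) ∧ ¬ γ.rel (emb a) (Sum.inl none))
      iseqv := by
        refine ⟨fun a => Or.inl rfl, ?_, ?_⟩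
        · rintro a b (rfl | ⟨h, k⟩)
          · exact Or.inl rfl
          · exact Or.inr ⟨Setoid.symm' _ h, fun k' => k (Setoid.trans' _ h k')⟩
        · rintro a b c (rfl | ⟨h, k⟩) (rfl | ⟨h₂, k₂⟩)
          · exact Or.inl rfl
          · exact Or.inr ⟨h₂, k₂⟩
          · exact Or.inr ⟨h, k⟩
          · exact Or.inr ⟨Setoid.trans' _ h h₂, k⟩ }
  block := by
    rintro _ ⟨a, rfl⟩
    by_cases ha : γ.rel (emb a) (Sum.inl none)
    · refine Or.inl ⟨a, Set.ext fun b => ⟨?_, fun h => Or.inl h⟩⟩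
      rintro (h | ⟨h, k⟩)
      · exact h
      · exact absurd (Setoid.trans' _ h ha) k
    · obtain ⟨x, hx⟩ := γ.exists_inl (emb a)
      obtain ⟨y, hy⟩ := γ.exists_inr (emb a)
      rcases x with _ | x
      · exact absurd (Setoid.symm' _ hx) ha
      rcases y with _ | y
      · exact absurd (Setoid.symm' _ (Setoid.trans' _ hγ hy)) ha
      exact Or.inr ⟨⟨x, Or.inr ⟨hx, fun k => ha (Setoid.trans' _ (Setoid.symm' _ hx) k)⟩⟩,
        y, Or.inr ⟨hy, fun k => ha (Setoid.trans' _ (Setoid.symm' _ hy) k)⟩⟩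

theorem mem_extra_unbar (γ : IStar (Option X)) (hγ : γ.rel (Sum.inl none) (Sum.inr none))
    (a : Option X ⊕ Option X) : a ∈ (unbar γ hγ).extra ↔ γ.rel a (Sum.inl none) := by
  constructor
  · rintro ((rfl | rfl) | ⟨a, ha, rfl⟩)
    · exact Setoid.refl' _ _
    · exact Setoid.symm' _ hγ
    · by_contra hna
      obtain ⟨x, hx⟩ := γ.exists_inl (emb a)
      obtain ⟨y, hy⟩ := γ.exists_inr (emb a)
      rcases x with _ | x
      · exact hna (Setoid.symm' _ hx)
      rcases y with _ | y
      · exact hna (Setoid.symm' _ (Setoid.trans' _ hγ hy))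
      have h₁ := eq_of_point (b := Sum.inl x) ha (Or.inr ⟨Setoid.symm' _ hx, hna⟩)
      have h₂ := eq_of_point (b := Sum.inr y) ha (Or.inr ⟨Setoid.symm' _ hy, hna⟩)
      rw [h₁] at h₂
      exact Sum.inl_ne_inr h₂
  · intro h
    have key : ∀ b : X ⊕ X, γ.rel (emb b) (Sum.inl none) → emb b ∈ (unbar γ hγ).extra := by
      refine fun b hb => Or.inr ⟨b, ⟨b, Set.ext fun c => ⟨fun hc => Or.inl hc, ?_⟩⟩, rfl⟩
      rintro (hc | ⟨hc, k⟩)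
      · exact hc
      · exact absurd (Setoid.trans' _ hc hb) k
    rcases a with (_ | x) | (_ | x)
    · exact Or.inl (Or.inl rfl)
    · exact key (Sum.inl x) h
    · exact Or.inl (Or.inr rfl)
    · exact key (Sum.inr x) h

theorem bar_unbar (γ : IStar (Option X)) (hγ : γ.rel (Sum.inl none) (Sum.inr none)) :
    (unbar γ hγ).bar = γ := by
  refine IStar.ext (Setoid.ext fun a b => ⟨?_, fun h => ?_⟩)
  · rintro (⟨ha, hb⟩ | ⟨u, v, rfl, rfl, (rfl | ⟨h, -⟩)⟩)
    · rw [mem_extra_unbar] at ha hb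
      exact Setoid.trans' _ ha (Setoid.symm' _ hb)
    · exact Setoid.refl' _ _
    · exact h
  · by_cases ha : γ.rel a (Sum.inl none)
    · exact Or.inl ⟨(mem_extra_unbar γ hγ a).2 ha,
        (mem_extra_unbar γ hγ b).2 (Setoid.trans' _ (Setoid.symm' _ h) ha)⟩
    · have key : ∀ c, ¬ γ.rel c (Sum.inl none) → ∃ u, emb u = c := by
        rintro ((_ | x) | (_ | x)) hc
        · exact absurd (Setoid.refl' _ _) hc
        · exact ⟨Sum.inl x, rfl⟩
        · exact absurd (Setoid.symm' _ hγ) hc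
        · exact ⟨Sum.inr x, rfl⟩
      obtain ⟨u, rfl⟩ := key a ha
      obtain ⟨v, rfl⟩ := key b fun hb => ha (Setoid.trans' _ h hb)
      exact Or.inr ⟨u, v, rfl, rfl, Or.inr ⟨h, ha⟩⟩

theorem bar_mul_bar_none (α β : PIStar X) :
    (α.bar * β.bar).rel (Sum.inl none) (Sum.inr none) :=
  Setoid.trans' (α.bar.rel.map upper ⊔ β.bar.rel.map lower)
    (IStar.upper_rel α.bar_none) (IStar.lower_rel β.bar_none)

/-- The product of `PI*_X`: the element `α ⋆ β` with `bar (α ⋆ β) = ᾱ β̄`. -/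
instance : Mul (PIStar X) where
  mul α β := unbar (α.bar * β.bar) (bar_mul_bar_none α β)

theorem bar_mul (α β : PIStar X) : (α * β).bar = α.bar * β.bar := bar_unbar _ _

theorem bar_injective : Function.Injective (bar : PIStar X → IStar (Option X)) := by
  have key : ∀ (α : PIStar X) a b, α.rel a b ↔ α.bar.rel (emb a) (emb b) ∧
      (α.bar.rel (emb a) (Sum.inl none) → a = b) := by
    intro α a b
    constructor
    · refine fun h => ⟨Or.inr ⟨a, b, rfl, rfl, h⟩, ?_⟩
      rintro (⟨ha, -⟩ | ⟨u, v, -, hv, -⟩)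
      · exact mem_extra_of_rel ha h
      · rcases v with v | v <;> simp [emb] at hv
    · rintro ⟨⟨ha, -⟩ | ⟨u, v, hu, hv, h⟩, k⟩
      · rw [k (Or.inl ⟨ha, Or.inl (Or.inl rfl)⟩)]
      · rwa [emb_injective hu, emb_injective hv] at h
  intro α β h
  exact PIStar.ext (Setoid.ext fun a b => by rw [key, key, h])

/-- The inverse of `{A_i ∪ B_i'}` is `{B_i ∪ A_i'}`: the diagram is turned upside down. -/
instance : Inv (PIStar X) where
  inv α :=
    { rel := α.rel.comap Sum.swap
      block := by
        rintro _ ⟨a, rfl⟩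
        rcases α.block _ ⟨a.swap, rfl⟩ with ⟨b, hb⟩ | ⟨⟨x, hx⟩, y, hy⟩
        · refine Or.inl ⟨b.swap, Set.ext fun c => (Set.ext_iff.1 hb c.swap).trans ?_⟩
          exact ⟨fun h => by rw [← Set.mem_singleton_iff.1 h, Sum.swap_swap]; rfl,
            fun h => by rw [Set.mem_singleton_iff.1 h, Sum.swap_swap]; rfl⟩
        · exact Or.inr ⟨⟨y, hy⟩, x, hx⟩ }

/-- The permutation `g` as the element with blocks `{t, g(t)'}`. -/
def ofPerm (g : Equiv.Perm X) : PIStar X where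
  rel := Setoid.ker (Sum.elim g id)
  block := by
    rintro _ ⟨a, rfl⟩
    refine Or.inr ⟨⟨g.symm (Sum.elim g id a), ?_⟩, Sum.elim g id a, ?_⟩ <;>
      simp

/-- The symmetric group `S_X` inside `PI*_X`. -/
def symm (X : Type*) : Set (PIStar X) := Set.range ofPerm

/-- The blocks of `γ_{x,y}`: the generalised line `{x, y, x'}`, the point `{y'}`, and the lines
`{t, t'}` for `t ≠ x, y`. -/
def gammaBlocks (x y : X) : Set (Set (X ⊕ X)) :=
  {{Sum.inl x, Sum.inl y, Sum.inr x}, {Sum.inr y}} ∪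
    {A | ∃ t, t ≠ x ∧ t ≠ y ∧ A = {Sum.inl t, Sum.inr t}}

theorem gammaBlocks_isPartition {x y : X} (h : x ≠ y) :
    Setoid.IsPartition (gammaBlocks x y) := by
  constructor
  · rintro ((h | h) | ⟨t, -, -, h⟩)
    · exact (Set.insert_nonempty _ _).ne_empty h.symm
    · exact Set.singleton_ne_empty _ h.symm
    · exact (Set.insert_nonempty _ _).ne_empty h.symm
  · have e : ∀ a, ∃ A ∈ gammaBlocks x y, a ∈ A := by
      rintro (t | t)
      · by_cases hx : t = x
        · exact ⟨_, Or.inl (Or.inl rfl), by simp [hx]⟩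
        by_cases hy : t = y
        · exact ⟨_, Or.inl (Or.inl rfl), by simp [hy]⟩
        exact ⟨_, Or.inr ⟨t, hx, hy, rfl⟩, by simp⟩
      · by_cases hx : t = x
        · exact ⟨_, Or.inl (Or.inl rfl), by simp [hx]⟩
        by_cases hy : t = y
        · exact ⟨_, Or.inl (Or.inr rfl), by simp [hy]⟩
        exact ⟨_, Or.inr ⟨t, hx, hy, rfl⟩, by simp⟩
    intro a
    obtain ⟨A, hA, ha⟩ := e a
    refine ⟨A, ⟨hA, ha⟩, ?_⟩
    rintro B ⟨hB, hb⟩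
    rcases hA with (rfl | rfl) | ⟨t, htx, hty, rfl⟩ <;>
      rcases hB with (rfl | rfl) | ⟨s, hsx, hsy, rfl⟩ <;>
      rcases a with a | a <;> grind

/-- The element `γ_{x,y}`, for `x ≠ y`. -/
def gamma (x y : X) (h : x ≠ y) : PIStar X where
  rel := Setoid.mkClasses (gammaBlocks x y) (gammaBlocks_isPartition h).2
  block := by
    rw [Setoid.classes_mkClasses _ (gammaBlocks_isPartition h)]
    rintro A ((rfl | rfl) | ⟨t, -, -, rfl⟩)
    · exact Or.inr ⟨⟨x, by simp⟩, x, by simp⟩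
    · exact Or.inl ⟨_, rfl⟩
    · exact Or.inr ⟨⟨t, by simp⟩, t, by simp⟩

end PIStar

/-- `A` generates `S` as an inverse semigroup: the only subset of `S` that contains `A` and is
closed under products and inverses is `S`. -/
def GeneratesAsInverseSemigroup {S : Type*} [Mul S] [Inv S] (A : Set S) : Prop :=
  ∀ T : Subsemigroup S, (∀ a ∈ T, a⁻¹ ∈ T) → A ⊆ T → T = ⊤

/-! Write `n` for the size of `X`. An element `u` is handled through a labelling of both rows of `ū`
whose fibres are the blocks; the product is then computed by labelling the middle row compatibly
(`Lab.mul`).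

Generation: choose a representative of every block of `ū` in the top row and another in the bottom
row, taking `x̄` and `x̄'` for the extra block. Then `u` factors as (gather the top vertices onto
representatives) · (permutation) · (fan out from representatives). The outer factors are products of
elementary merges, each a conjugate of `γ` or an `e⁻¹e` with `e` such a conjugate, besides an
identity factor (`exists_mem_lab_of_idempotent`, `eq_top_of_gamma_mem`).

Necessity: two inverse subsemigroups contain the symmetric group but not `γ`: the elements without
points, and the elements that contain a permutation or have at most `n - 1` blocks in `ū`. A
generating `u` avoids both. With at least `n` blocks on rows of `n + 1` vertices, each row has at
most one coincidence; a top point `z` gives the pair `x̄, z` there and forces a coinciding pair at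
the bottom. If the bottom pair involves `x̄'`, then `u` contains a permutation; otherwise `u` is
`γ⁻¹` up to permutations (`exists_eq_perm_mul_inv_gamma_mul_perm`). Bottom points reduce to this by
inversion. -/

namespace PIStar

open PartitionDiagram

variable {X W U V : Type*}

/-! ### Labellings of diagrams and their products -/

/-- The map `Sum.elim p q` separates exactly the blocks of `ū`. -/
def Lab (u : PIStar X) (p q : Option X → W) : Prop :=
  ∀ a b, u.bar.rel a b ↔ Sum.elim p q a = Sum.elim p q b

theorem Lab.unique {u v : PIStar X} {p q : Option X → W} (hu : Lab u p q) (hv : Lab v p q) :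
    u = v :=
  bar_injective (IStar.ext (Setoid.ext fun a b => (hu a b).trans (hv a b).symm))

theorem Lab.comp_iff {u : PIStar X} {p q : Option X → W} {f : W → U} (hf : f.Injective) :
    Lab u (f ∘ p) (f ∘ q) ↔ Lab u p q := by
  simp only [Lab, ← Sum.comp_elim, Function.comp_apply, hf.eq_iff]

theorem lab_quotient (u : PIStar X) :
    Lab u (fun x => Quotient.mk u.bar.rel (Sum.inl x)) (fun x => Quotient.mk u.bar.rel (Sum.inr x)) := by
  rintro (a | a) (b | b) <;> exact Quotient.eq.symm

theorem Lab.exists_inr {u : PIStar X} {p q : Option X → W} (h : Lab u p q) (x : Option X) :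
    ∃ y, q y = p x :=
  (u.bar.exists_inr (Sum.inl x)).imp fun y hy => (h (Sum.inr y) (Sum.inl x)).1 hy

theorem Lab.exists_inl {u : PIStar X} {p q : Option X → W} (h : Lab u p q) (y : Option X) :
    ∃ x, p x = q y :=
  (u.bar.exists_inl (Sum.inr y)).imp fun x hx => (h (Sum.inl x) (Sum.inr y)).1 hx

theorem Lab.none {u : PIStar X} {p q : Option X → W} (h : Lab u p q) : p none = q none :=
  (h _ _).1 u.bar_none

theorem natMul_le {Y : Type*} {α β : Setoid (Y ⊕ Y)} (h : Y ⊕ (Y ⊕ Y) → U)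
    (hα : ∀ a b, α a b → h (upper a) = h (upper b))
    (hβ : ∀ a b, β a b → h (lower a) = h (lower b)) {a b : Y ⊕ Y} (hab : natMul α β a b) :
    h (outer a) = h (outer b) := by
  have key : α.map upper ⊔ β.map lower ≤ Setoid.ker h := by
    refine sup_le ?_ ?_ <;> refine Setoid.eqvGen_le ?_
    · rintro _ _ ⟨a, b, hab, rfl, rfl⟩
      exact hα a b hab
    · rintro _ _ ⟨a, b, hab, rfl, rfl⟩
      exact hβ a b hab
  exact key hab

/-- Here `c` labels the middle row. `htc` and `hcb` make the labels constant on components. `hc`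
makes them separate components: every outer vertex is linked to a middle one, and equal middle
labels are joined by a path through one vertex `z`. Such short paths suffice for all products formed
below. -/
theorem Lab.mul {u v : PIStar X} {p q : Option X → W} {r s : Option X → V}
    (hu : Lab u p q) (hv : Lab v r s) (t c b : Option X → U)
    (htc : ∀ x m, p x = q m → t x = c m) (hcb : ∀ m y, r m = s y → c m = b y)
    (hc : ∀ m m', c m = c m' →
      ∃ z, (q m = q z ∨ r m = r z) ∧ (q m' = q z ∨ r m' = r z)) :
    Lab (u * v) t b := by
  have hmid : ∀ m m', q m = q m' ∨ r m = r m' →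
      (u.bar.rel.map upper ⊔ v.bar.rel.map lower) (Sum.inr (Sum.inl m)) (Sum.inr (Sum.inl m')) := by
    rintro m m' (h | h)
    · exact IStar.upper_rel (a := Sum.inr m) (b := Sum.inr m') ((hu _ _).2 h)
    · exact IStar.lower_rel (a := Sum.inl m) (b := Sum.inl m') ((hv _ _).2 h)
  have hlink : ∀ a, ∃ m, c m = Sum.elim t b a ∧
      (u.bar.rel.map upper ⊔ v.bar.rel.map lower) (outer a) (Sum.inr (Sum.inl m)) := by
    rintro (x | y)
    · obtain ⟨m, hm⟩ := hu.exists_inr x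
      exact ⟨m, (htc x m hm.symm).symm,
        IStar.upper_rel (a := Sum.inl x) (b := Sum.inr m) ((hu _ _).2 hm.symm)⟩
    · obtain ⟨m, hm⟩ := hv.exists_inl y
      exact ⟨m, hcb m y hm,
        IStar.lower_rel (a := Sum.inr y) (b := Sum.inl m) ((hv _ _).2 hm.symm)⟩
  intro a a'
  rw [bar_mul, IStar.mul_rel]
  constructor
  · intro h
    have := natMul_le (Sum.elim t (Sum.elim c b)) ?_ ?_ h
    · rcases a with a | a <;> rcases a' with a' | a' <;> exact this
    · have key : ∀ a m, u.bar.rel a (Sum.inr m) → Sum.elim t (Sum.elim c b) (upper a) = c m := by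
        rintro (x | y) m h
        · exact htc x m ((hu _ _).1 h)
        · obtain ⟨x, hx⟩ := hu.exists_inl y
          exact (htc x y hx).symm.trans (htc x m (hx.trans ((hu _ _).1 h)))
      intro a b hab
      obtain ⟨m, hm⟩ := u.bar.exists_inr b
      rw [key b m (Setoid.symm' _ hm), key a m (Setoid.trans' _ hab (Setoid.symm' _ hm))]
    · have key : ∀ a m, v.bar.rel a (Sum.inl m) → Sum.elim t (Sum.elim c b) (lower a) = c m := by
        rintro (x | y) m h
        · obtain ⟨y, hy⟩ := hv.exists_inr x
          exact (hcb x y hy.symm).trans (hcb m y (((hv _ _).1 h).symm.trans hy.symm)).symm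
        · exact (hcb m y ((hv _ _).1 h).symm).symm
      intro a b hab
      obtain ⟨m, hm⟩ := v.bar.exists_inl b
      rw [key b m (Setoid.symm' _ hm), key a m (Setoid.trans' _ hab (Setoid.symm' _ hm))]
  · intro h
    obtain ⟨m, hm, h₁⟩ := hlink a
    obtain ⟨m', hm', h₂⟩ := hlink a'
    obtain ⟨z, hz, hz'⟩ := hc m m' (by rw [hm, hm', h])
    exact Setoid.trans' (u.bar.rel.map upper ⊔ v.bar.rel.map lower) (Setoid.trans' _ h₁ (hmid _ _ hz))
      (Setoid.symm' _ (Setoid.trans' _ h₂ (hmid _ _ hz')))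

/-- Passes from `u` to `ū`: the label of `none` marks the points, so `u` is `unbar` of the kernel of
the labelling. -/
theorem lab_of_rel {u : PIStar X} {p q : Option X → W} (h0 : p none = q none)
    (hp : ∀ x, ∃ y, q y = p x) (hq : ∀ y, ∃ x, p x = q y)
    (h : ∀ a b, u.rel a b ↔ a = b ∨ (Sum.elim p q (emb a) = Sum.elim p q (emb b) ∧
      Sum.elim p q (emb a) ≠ p none)) : Lab u p q := by
  let δ : IStar (Option X) :=
    { rel := Setoid.ker (Sum.elim p q)
      block := by
        rintro _ ⟨x | y, rfl⟩
        · obtain ⟨y, hy⟩ := hp x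
          exact ⟨⟨x, rfl⟩, y, hy⟩
        · obtain ⟨x, hx⟩ := hq y
          exact ⟨⟨x, hx⟩, y, rfl⟩ }
  have hδ : δ.rel (Sum.inl none) (Sum.inr none) := h0
  have : u = unbar δ hδ := PIStar.ext (Setoid.ext fun a b => h a b)
  intro a b
  rw [this, bar_unbar]
  rfl

theorem inv_bar_rel (u : PIStar X) (a b : Option X ⊕ Option X) :
    u⁻¹.bar.rel a b ↔ u.bar.rel a.swap b.swap := by
  have hs : ∀ (v : PIStar X) a b, v.bar.rel a b → v⁻¹.bar.rel a.swap b.swap := by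
    intro v
    have hx : ∀ a, a ∈ v.extra → a.swap ∈ v⁻¹.extra := by
      rintro _ ((rfl | rfl) | ⟨a, ⟨c, hc⟩, rfl⟩)
      · exact Or.inl (Or.inr rfl)
      · exact Or.inl (Or.inl rfl)
      · refine Or.inr ⟨a.swap, ⟨c.swap, Set.ext fun b => ?_⟩, by rcases a with a | a <;> rfl⟩
        have := Set.ext_iff.1 hc b.swap
        refine Iff.trans ?_ (this.trans ?_)
        · simp only [Set.mem_singleton_iff]
          exact ⟨fun h => by rw [h, Sum.swap_swap], fun h => by rw [← h, Sum.swap_swap]⟩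
        · change _ ↔ v.rel b.swap c.swap.swap
          rw [Sum.swap_swap]
          rfl
    rintro a b (⟨ha, hb⟩ | ⟨c, d, rfl, rfl, hcd⟩)
    · exact Or.inl ⟨hx a ha, hx b hb⟩
    · refine Or.inr ⟨c.swap, d.swap, by rcases c with c | c <;> rfl,
        by rcases d with d | d <;> rfl, ?_⟩
      change v.rel c.swap.swap d.swap.swap
      rwa [Sum.swap_swap, Sum.swap_swap]
  have hi : u⁻¹⁻¹ = u := PIStar.ext (Setoid.ext fun a b => by
    change u.rel a.swap.swap b.swap.swap ↔ _
    rw [Sum.swap_swap, Sum.swap_swap])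
  refine ⟨fun h => ?_, fun h => ?_⟩
  · have := hs _ _ _ h
    rwa [hi] at this
  · have := hs _ _ _ h
    rwa [Sum.swap_swap, Sum.swap_swap] at this

theorem Lab.inv {u : PIStar X} {p q : Option X → W} (h : Lab u p q) : Lab u⁻¹ q p := by
  intro a b
  rw [inv_bar_rel, h]
  rcases a with a | a <;> rcases b with b | b <;> rfl

theorem lab_ofPerm (g : Equiv.Perm X) : Lab (ofPerm g) (Option.map g) id := by
  refine lab_of_rel rfl (fun x => ⟨_, rfl⟩) (fun y => ⟨y.map g.symm, by simp⟩) ?_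
  intro a b
  change Sum.elim g id a = Sum.elim g id b ↔ _
  rcases a with a | a <;> rcases b with b | b <;> simp [emb]

theorem Lab.perm_mul {u : PIStar X} {p q : Option X → W} (h : Lab u p q) (g : Equiv.Perm X) :
    Lab (ofPerm g * u) (p ∘ Option.map g) q :=
  (lab_ofPerm g).mul h _ p _ (fun _ _ hm => congrArg p hm) (fun _ _ h => h)
    fun _ m' h => ⟨m', Or.inr h, Or.inl rfl⟩

theorem Lab.mul_perm {u : PIStar X} {p q : Option X → W} (h : Lab u p q) (g : Equiv.Perm X) :
    Lab (u * ofPerm g) p (q ∘ Option.map g.symm) :=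
  h.mul (lab_ofPerm g) _ q _ (fun _ _ h => h) (fun m y hm => by
    obtain rfl : Option.map g m = y := hm
    simp)
    fun _ m' h => ⟨m', Or.inl h, Or.inl rfl⟩

theorem Lab.perm_mul_perm {u v : PIStar X} {p q : Option X → W} {g h : Equiv.Perm X}
    (hu : Lab u p q) (hv : Lab v (p ∘ Option.map g) (q ∘ Option.map h)) :
    v = ofPerm g * u * ofPerm h.symm :=
  hv.unique ((hu.perm_mul g).mul_perm h.symm)

theorem exists_perm_map_eq [Finite X] {s : Option X → Option X} (hs : s.Injective)
    (h0 : s none = none) : ∃ g : Equiv.Perm X, Option.map g = s := by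
  have h : ∀ x : X, ∃ y, s (some x) = some y := fun x =>
    Option.ne_none_iff_exists'.1 fun hx => Option.some_ne_none x (hs (hx.trans h0.symm))
  choose f hf using h
  have hfi : f.Injective := fun a b hab =>
    Option.some_injective _ (hs (by rw [hf, hf, hab]))
  refine ⟨Equiv.ofBijective f (Finite.injective_iff_bijective.1 hfi), funext fun z => ?_⟩
  cases z with
  | none => exact h0.symm
  | some x => exact (hf x).symm

theorem map_perm_injective (g : Equiv.Perm X) : (Option.map g).Injective :=
  Option.map_injective g.injective

/-! ### Generation by permutations and `γ` -/

section decEq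

variable [DecidableEq X]

/-- The map that sends `b` to `a` and fixes all other elements of `X ∪ {x̄}`. -/
def move (b : X) (a : Option X) : Option X → Option X := Function.update id (some b) a

theorem move_apply (b : X) (a z : Option X) : move b a z = if z = some b then a else z := by
  simp [move, Function.update_apply]

/-- On top, `y` takes the label of `x`; at the bottom, the point `y'` takes the label of the extra
block. -/
theorem lab_gamma {x y : X} (h : x ≠ y) :
    Lab (gamma x y h) (move y (some x)) (move y none) := by
  refine lab_of_rel rfl (fun z => ⟨move y (some x) z, ?_⟩) (fun z => ⟨move y none z, ?_⟩) ?_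
  · grind [move_apply]
  · grind [move_apply]
  · intro a b
    change (∀ s ∈ gammaBlocks x y, a ∈ s → b ∈ s) ↔ _
    constructor
    · intro H
      obtain ⟨A, ⟨hA, ha⟩, -⟩ := (gammaBlocks_isPartition h).2 a
      have hb := H A hA ha
      rcases hA with (rfl | rfl) | ⟨t, htx, hty, rfl⟩ <;>
      rcases a with a | a <;> rcases b with b | b <;>
        simp [move_apply, emb] at ha hb ⊢ <;> grind
    · intro H A hA ha
      rcases hA with (rfl | rfl) | ⟨t, htx, hty, rfl⟩ <;>
      rcases a with a | a <;> rcases b with b | b <;>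
        simp [move_apply, emb] at ha H ⊢ <;> grind

theorem exists_perm_apply_eq {a b x y : X} (hab : a ≠ b) (hxy : x ≠ y) :
    ∃ g : Equiv.Perm X, g a = x ∧ g b = y := by
  refine ⟨(Equiv.swap a x).trans (Equiv.swap (Equiv.swap a x b) y), ?_, by simp⟩
  have : Equiv.swap a x b ≠ x := by
    intro h
    exact hab ((Equiv.swap a x).injective (h.trans (Equiv.swap_apply_left a x).symm)).symm
  simp [Equiv.swap_apply_of_ne_of_ne this.symm hxy]

theorem move_comp_map {b y : X} {g : Equiv.Perm X} (hb : g b = y) (c : Option X) :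
    move y (c.map g) ∘ Option.map g = Option.map g ∘ move b c := by
  funext z
  subst hb
  cases z <;> simp only [Function.comp_apply, move_apply] <;> grind [Option.map_injective, g.injective]

theorem exists_mem_lab_move {T : Subsemigroup (PIStar X)}
    (hinv : ∀ a ∈ T, a⁻¹ ∈ T) (hS : symm X ⊆ T) {x y : X} {hxy : x ≠ y} (hγ : gamma x y hxy ∈ T)
    {b : X} {a : Option X} (hab : a ≠ some b) :
    ∃ u ∈ T, Lab u (move b a) (move b none) := by
  have key : ∀ a : X, a ≠ b → ∃ u ∈ T, Lab u (move b (some a)) (move b none) := by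
    intro a hab
    obtain ⟨g, hgx, hgy⟩ := exists_perm_apply_eq hab hxy
    refine ⟨ofPerm g * gamma x y hxy * ofPerm g.symm,
      T.mul_mem (T.mul_mem (hS ⟨g, rfl⟩) hγ) (hS ⟨g.symm, rfl⟩), ?_⟩
    have := ((lab_gamma hxy).perm_mul g).mul_perm g.symm
    rw [← Lab.comp_iff (map_perm_injective g), ← move_comp_map hgy, ← move_comp_map hgy,
      Option.map_some, hgx]
    exact this
  cases a with
  | some a => exact key a fun h => hab (congrArg some h)
  | none =>
    obtain ⟨a, ha⟩ : ∃ a, a ≠ b := by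
      by_cases h : x = b
      · exact ⟨y, fun h' => hxy (h.trans h'.symm)⟩
      · exact ⟨x, h⟩
    obtain ⟨u, hu, hl⟩ := key a ha
    -- This product turns `b` and `b'` into points and acts as the identity elsewhere.
    refine ⟨u⁻¹ * u, T.mul_mem (hinv u hu) hu, hl.inv.mul hl _ (move b (some a)) _ ?_ ?_ ?_⟩
    · grind [move_apply]
    · grind [move_apply]
    · exact fun _ m' h => ⟨m', Or.inl h, Or.inl rfl⟩

/-- Induction on the number of vertices moved by `f`: one elementary factor merges a moved `b` into
`f b`. That factor turns `b'` into a point, which is why moved vertices have bottom label `none`. -/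
theorem exists_mem_lab_of_idempotent {T : Subsemigroup (PIStar X)}
    (hinv : ∀ a ∈ T, a⁻¹ ∈ T) (hS : symm X ⊆ T) {x y : X} {hxy : x ≠ y} (hγ : gamma x y hxy ∈ T)
    [Fintype X] (f : Option X → Option X) (h0 : f none = none)
    (hf : ∀ z, f (f z) = f z) :
    ∃ u ∈ T, Lab u f fun z => if f z = z then z else none := by
  induction hk : (Finset.univ.filter fun z => f z ≠ z).card generalizing f with
  | zero =>
    have hid : ∀ z, f z = z := by simpa [Finset.filter_eq_empty_iff] using hk
    have : f = Option.map (Equiv.refl X) := funext fun z => by simp [hid]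
    refine ⟨ofPerm (Equiv.refl X), hS ⟨_, rfl⟩, ?_⟩
    have h := lab_ofPerm (Equiv.refl X)
    rw [← this] at h
    simp only [hid, if_true]
    exact h
  | succ k ih =>
    obtain ⟨b, hb⟩ := Finset.card_pos.1 (Nat.lt_of_lt_of_eq (Nat.succ_pos k) hk.symm)
    have hb := (Finset.mem_filter.1 hb).2
    cases b with
    | none => exact absurd h0 hb
    | some b =>
      -- A moved `b` is not in the image of the idempotent `f`, so resetting its value to `b` keeps
      -- idempotency and removes exactly one moved vertex.
      obtain ⟨u, hu, hul⟩ := ih (Function.update f (some b) (some b)) (by simp [h0])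
        (by grind [Function.update_apply]) (by
          have : (Finset.univ.filter fun z => Function.update f (some b) (some b) z ≠ z) =
              (Finset.univ.filter fun z => f z ≠ z).erase (some b) := by
            ext z
            simp only [Finset.mem_filter, Finset.mem_erase, Finset.mem_univ, true_and]
            grind [Function.update_apply]
          rw [this, Finset.card_erase_of_mem (by simpa using hb), hk, Nat.add_sub_cancel])
      obtain ⟨v, hv, hvl⟩ := exists_mem_lab_move hinv hS hγ hb
      refine ⟨u * v, T.mul_mem hu hv, hul.mul hvl f
        (fun z => if z = some b then f z else if f z = z then z else none) _ ?_ ?_ ?_⟩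
      · intro z m
        grind [Function.update_apply]
      · intro m z
        grind [move_apply]
      · intro m m' h
        -- The middle label of `m`, read as a middle vertex, is the connecting vertex.
        refine ⟨if m = some b then f m else if f m = m then m else none, ?_, ?_⟩
        · grind [Function.update_apply, move_apply]
        · rw [h]
          grind [Function.update_apply, move_apply]

theorem eq_top_of_gamma_mem {T : Subsemigroup (PIStar X)}
    (hinv : ∀ a ∈ T, a⁻¹ ∈ T) (hS : symm X ⊆ T) {x y : X} {hxy : x ≠ y} (hγ : gamma x y hxy ∈ T)
    [Fintype X] : T = ⊤ := by
  rw [eq_top_iff]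
  rintro u -
  obtain ⟨W, p, q, hl, hsurj⟩ : ∃ (W : Type _) (p q : Option X → W), Lab u p q ∧
      ∀ w, ∃ z, p z = w := by
    refine ⟨_, _, _, lab_quotient u, fun w => ?_⟩
    induction w using Quotient.ind with
    | _ a => exact (u.bar.exists_inl a).imp fun z hz => Quotient.sound hz
  have hsurj' : ∀ w, ∃ z, q z = w := fun w => by
    obtain ⟨z, rfl⟩ := hsurj w
    exact hl.exists_inr z
  -- The representative of the extra block must be `none`, so that the representatives can be
  -- matched by a permutation of `X` rather than of `Option X`.
  have hsec : ∀ r : Option X → W, (∀ w, ∃ z, r z = w) →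
      ∃ σ : W → Option X, (∀ w, r (σ w) = w) ∧ σ (r none) = none := by
    intro r hr
    choose σ hσ using hr
    classical
    refine ⟨Function.update σ (r none) none, fun w => ?_, by simp⟩
    by_cases h : w = r none
    · simp [h]
    · simp [h, hσ]
  obtain ⟨σ, hσ, hσ0⟩ := hsec p hsurj
  obtain ⟨τ, hτ, hτ0⟩ := hsec q hsurj'
  rw [← hl.none] at hτ0
  have hσi : σ.Injective := Function.LeftInverse.injective hσ
  have hτi : τ.Injective := Function.LeftInverse.injective hτ
  obtain ⟨g, hg⟩ : ∃ g : Equiv.Perm X, ∀ w, (σ w).map g = τ w := by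
    classical
    -- The matching of top representatives with bottom representatives of the same blocks is a
    -- partial injection, hence extends to a bijection by finiteness.
    obtain ⟨e, he⟩ := Finset.exists_equiv_extend_of_card_eq (α := Option X) (β := Option X)
      (t := Finset.univ) (by simp) (s := Finset.univ.filter fun z => σ (p z) = z)
      (f := fun z => τ (p z)) (by simp) (by
        intro z hz z' hz' h
        simp only [Finset.coe_filter, Finset.mem_univ, true_and, Set.mem_ofPred_eq] at hz hz'
        rw [← hz, ← hz', hτi h])
    have he' : ∀ w, (e (σ w) : Option X) = τ w := fun w => by
      have := he (σ w) (by simp [hσ])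
      rwa [hσ] at this
    obtain ⟨g, hg⟩ := exists_perm_map_eq (s := fun z => (e z : Option X))
      (fun a b h => e.injective (Subtype.ext h)) (by
        have := he' (p none)
        rwa [hσ0, hτ0] at this)
    exact ⟨g, fun w => (congrFun hg _).trans (he' w)⟩
  obtain ⟨v, hv, hvl⟩ := exists_mem_lab_of_idempotent hinv hS hγ (fun z => σ (p z)) hσ0
    (fun z => by rw [hσ])
  obtain ⟨w, hw, hwl⟩ := exists_mem_lab_of_idempotent hinv hS hγ (fun z => τ (q z))
    (by rw [← hl.none, hτ0]) (fun z => by rw [hτ])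
  have hgσ : ∀ z, σ (p z) = z ↔ τ (q (z.map g)) = z.map g := by
    intro z
    constructor
    · intro h
      rw [← h, hg, hτ]
    · intro h
      rw [← hg] at h
      rw [← map_perm_injective g h, hσ]
  have hprod : Lab (v * ofPerm g * w⁻¹) (fun z => τ (p z)) (fun z => τ (q z)) := by
    refine (hvl.mul_perm g).mul hwl.inv _ (fun z => if τ (q z) = z then z else none) _ ?_ ?_ ?_
    · intro z m h
      obtain ⟨m, rfl⟩ : ∃ m', m = Option.map g m' := ⟨m.map g.symm, by simp⟩
      have h' := congrArg (Option.map g) h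
      simp only [Function.comp_apply, Option.map_map, Equiv.symm_comp_self, Option.map_id, id] at h'
      rw [hg] at h'
      rw [h']
      simp only [hgσ m]
      split_ifs <;> rfl
    · exact fun _ _ h => h
    · exact fun _ m' h => ⟨m', Or.inr h, Or.inl rfl⟩
  rw [hl.unique ((Lab.comp_iff hτi).1 hprod)]
  exact T.mul_mem (T.mul_mem hv (hS ⟨g, rfl⟩)) (hinv w hw)

end decEq

/-! ### Two inverse subsemigroups containing the symmetric group -/

/-- The elements without points form a subsemigroup. -/
def noPoints (X : Type*) : Subsemigroup (PIStar X) where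
  carrier := {u | ∀ a b, u.bar.rel a b →
    Sum.elim Option.isSome Option.isSome a = Sum.elim Option.isSome Option.isSome b}
  mul_mem' := by
    intro u v hu hv a b hab
    rw [bar_mul, IStar.mul_rel] at hab
    have := natMul_le (Sum.elim Option.isSome (Sum.elim Option.isSome Option.isSome)) ?_ ?_ hab
    · rcases a with a | a <;> rcases b with b | b <;> exact this
    · intro a b h
      have := hu a b h
      rcases a with a | a <;> rcases b with b | b <;> exact this
    · exact hv

theorem inv_mem_noPoints {u : PIStar X} (hu : u ∈ noPoints X) : u⁻¹ ∈ noPoints X := by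
  intro a b hab
  have := hu _ _ ((inv_bar_rel u a b).1 hab)
  rcases a with a | a <;> rcases b with b | b <;> exact this

theorem ofPerm_mem_noPoints (g : Equiv.Perm X) : ofPerm g ∈ noPoints X := by
  intro a b hab
  have := congrArg Option.isSome ((lab_ofPerm g a b).1 hab)
  rcases a with a | a <;> rcases b with b | b <;> simpa using this

/-- `u` contains the lines of a permutation. -/
def ContainsPerm (u : PIStar X) : Prop :=
  ∃ g : Equiv.Perm X, ∀ x, u.bar.rel (Sum.inl x) (Sum.inr (x.map g))

/-- `ū` has at most `k` blocks. -/
def BlocksLE (k : ℕ) (u : PIStar X) : Prop :=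
  ∃ A : Finset (Option X ⊕ Option X), A.card ≤ k ∧ ∀ b, ∃ a ∈ A, u.bar.rel a b

theorem ContainsPerm.mul {u v : PIStar X} (hu : ContainsPerm u) (hv : ContainsPerm v) :
    ContainsPerm (u * v) := by
  obtain ⟨g, hg⟩ := hu
  obtain ⟨h, hh⟩ := hv
  refine ⟨g.trans h, fun x => ?_⟩
  rw [bar_mul]
  have := hh (x.map g)
  rw [Option.map_map] at this
  exact Setoid.trans' (u.bar.rel.map upper ⊔ v.bar.rel.map lower)
    (IStar.upper_rel (hg x)) (IStar.lower_rel this)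

theorem ContainsPerm.inv {u : PIStar X} (hu : ContainsPerm u) : ContainsPerm u⁻¹ := by
  obtain ⟨g, hg⟩ := hu
  refine ⟨g.symm, fun x => ?_⟩
  rw [inv_bar_rel]
  have := hg (x.map g.symm)
  rw [Option.map_map, Equiv.self_comp_symm, Option.map_id, id] at this
  exact Setoid.symm' _ this

/-- Every component of the stacked diagram contains a block of `ū`, and every such block has a
representative in the top row, which survives in the product. -/
theorem BlocksLE.mul_right {k : ℕ} {u : PIStar X} (hu : BlocksLE k u) (v : PIStar X) :
    BlocksLE k (u * v) := by
  classical
  obtain ⟨A, hA, hu⟩ := hu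
  choose f hf using u.bar.exists_inl
  refine ⟨A.image fun a => Sum.inl (f a), Finset.card_image_le.trans hA, fun b => ?_⟩
  rw [bar_mul]
  have key : ∀ c, ∃ a ∈ A.image fun a => (Sum.inl (f a) : Option X ⊕ Option X),
      (u.bar.rel.map upper ⊔ v.bar.rel.map lower) (outer a) (upper c) := by
    intro c
    obtain ⟨a, ha, hac⟩ := hu c
    exact ⟨_, Finset.mem_image_of_mem _ ha,
      IStar.upper_rel (a := Sum.inl (f a)) (Setoid.trans' _ (hf a) hac)⟩
  rcases b with x | y
  · exact key (Sum.inl x)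
  · obtain ⟨m, hm⟩ := v.bar.exists_inl (Sum.inr y)
    obtain ⟨a, ha, hac⟩ := key (Sum.inr m)
    exact ⟨a, ha, Setoid.trans' (u.bar.rel.map upper ⊔ v.bar.rel.map lower) hac
      (IStar.lower_rel hm)⟩

theorem BlocksLE.mul_left {k : ℕ} {v : PIStar X} (hv : BlocksLE k v) (u : PIStar X) :
    BlocksLE k (u * v) := by
  classical
  obtain ⟨A, hA, hv⟩ := hv
  choose f hf using v.bar.exists_inr
  refine ⟨A.image fun a => Sum.inr (f a), Finset.card_image_le.trans hA, fun b => ?_⟩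
  rw [bar_mul]
  have key : ∀ c, ∃ a ∈ A.image fun a => (Sum.inr (f a) : Option X ⊕ Option X),
      (u.bar.rel.map upper ⊔ v.bar.rel.map lower) (outer a) (lower c) := by
    intro c
    obtain ⟨a, ha, hac⟩ := hv c
    exact ⟨_, Finset.mem_image_of_mem _ ha,
      IStar.lower_rel (a := Sum.inr (f a)) (Setoid.trans' _ (hf a) hac)⟩
  rcases b with x | y
  · obtain ⟨m, hm⟩ := u.bar.exists_inr (Sum.inl x)
    obtain ⟨a, ha, hac⟩ := key (Sum.inl m)
    exact ⟨a, ha, Setoid.trans' (u.bar.rel.map upper ⊔ v.bar.rel.map lower) hac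
      (IStar.upper_rel hm)⟩
  · exact key (Sum.inr y)

theorem BlocksLE.inv {k : ℕ} {u : PIStar X} (hu : BlocksLE k u) : BlocksLE k u⁻¹ := by
  classical
  obtain ⟨A, hA, hu⟩ := hu
  refine ⟨A.image Sum.swap, Finset.card_image_le.trans hA, fun b => ?_⟩
  obtain ⟨a, ha, hab⟩ := hu b.swap
  refine ⟨_, Finset.mem_image_of_mem _ ha, ?_⟩
  rwa [inv_bar_rel, Sum.swap_swap]

/-- The elements that contain a permutation or have few blocks form a subsemigroup. -/
def permOrBlocksLE (X : Type*) (k : ℕ) : Subsemigroup (PIStar X) where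
  carrier := {u | ContainsPerm u ∨ BlocksLE k u}
  mul_mem' := by
    rintro u v (hu | hu) (hv | hv)
    · exact Or.inl (hu.mul hv)
    · exact Or.inr (hv.mul_left u)
    · exact Or.inr (hu.mul_right v)
    · exact Or.inr (hu.mul_right v)

theorem inv_inv' (u : PIStar X) : u⁻¹⁻¹ = u := (lab_quotient u).inv.inv.unique (lab_quotient u)

theorem perm_mul_mul_perm_inv (g h : Equiv.Perm X) (u : PIStar X) :
    (ofPerm g * u * ofPerm h)⁻¹ = ofPerm h.symm * u⁻¹ * ofPerm g.symm :=
  (((lab_quotient u).perm_mul g).mul_perm h).inv.unique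
    (((lab_quotient u).inv.perm_mul h.symm).mul_perm g.symm)

theorem perm_mul_mul_perm_cancel (g h : Equiv.Perm X) (u : PIStar X) :
    ofPerm g.symm * (ofPerm g * u * ofPerm h) * ofPerm h.symm = u := by
  refine Lab.unique (((((lab_quotient u).perm_mul g).mul_perm h).perm_mul g.symm).mul_perm h.symm) ?_
  simpa [Function.comp_assoc, Option.map_comp_map] using lab_quotient u

/-! ### Counting blocks and recognising the double coset -/

theorem BlocksLE.of_forall_exists_inl [Fintype X] {u : PIStar X} {a b : Option X} (hab : a ≠ b)
    (ha : ∃ c, c ≠ a ∧ c ≠ b ∧ u.bar.rel (Sum.inl c) (Sum.inl a))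
    (hb : ∃ c, c ≠ a ∧ c ≠ b ∧ u.bar.rel (Sum.inl c) (Sum.inl b)) :
    BlocksLE (Fintype.card X - 1) u := by
  classical
  -- The top row has `n + 1` vertices and meets every block; the `n - 1` left after dropping `a` and
  -- `b` still do.
  refine ⟨((Finset.univ.erase a).erase b).image Sum.inl, Finset.card_image_le.trans ?_, fun d => ?_⟩
  · rw [Finset.card_erase_of_mem (by simp [hab.symm]), Finset.card_erase_of_mem (by simp)]
    simp
  · obtain ⟨x, hx⟩ := u.bar.exists_inl d
    by_cases hxa : x = a
    · obtain ⟨c, hca, hcb, hc⟩ := ha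
      exact ⟨Sum.inl c, by simp [hca, hcb], Setoid.trans' _ hc (hxa ▸ hx)⟩
    by_cases hxb : x = b
    · obtain ⟨c, hca, hcb, hc⟩ := hb
      exact ⟨Sum.inl c, by simp [hca, hcb], Setoid.trans' _ hc (hxb ▸ hx)⟩
    · exact ⟨Sum.inl x, by simp [hxa, hxb], hx⟩

/-- If `ū` has at least `|X|` blocks and identifies two top vertices `a ≠ b`, then it identifies no
two top vertices other than `b`. -/
theorem eq_of_rel_inl [Fintype X] {u : PIStar X} (hu : ¬ BlocksLE (Fintype.card X - 1) u)
    {a b : Option X} (hab : a ≠ b) (h : u.bar.rel (Sum.inl a) (Sum.inl b)) {c d : Option X}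
    (hc : c ≠ b) (hd : d ≠ b) (hcd : u.bar.rel (Sum.inl c) (Sum.inl d)) : c = d := by
  by_contra hne
  by_cases hca : c = a
  · subst hca
    exact hu (.of_forall_exists_inl hd ⟨c, hne, hab, hcd⟩ ⟨c, hne, hab, h⟩)
  · refine hu (.of_forall_exists_inl hc ⟨d, Ne.symm hne, hd, Setoid.symm' _ hcd⟩
      ⟨a, Ne.symm hca, hab, h⟩)

theorem eq_of_rel_inr [Fintype X] {u : PIStar X} (hu : ¬ BlocksLE (Fintype.card X - 1) u)
    {a b : Option X} (hab : a ≠ b) (h : u.bar.rel (Sum.inr a) (Sum.inr b)) {c d : Option X}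
    (hc : c ≠ b) (hd : d ≠ b) (hcd : u.bar.rel (Sum.inr c) (Sum.inr d)) : c = d :=
  eq_of_rel_inl (u := u⁻¹) (fun h => hu (inv_inv' u ▸ h.inv)) hab ((inv_bar_rel _ _ _).2 h) hc hd
    ((inv_bar_rel _ _ _).2 hcd)

variable [DecidableEq X]

theorem gamma_notMem_noPoints {x y : X} (h : x ≠ y) : gamma x y h ∉ noPoints X := by
  intro hm
  have := hm (Sum.inr none) (Sum.inr (some y)) ((lab_gamma h _ _).2 (by simp [move_apply]))
  simp at this

/-- Both `x` and `y` could only be sent to `x`, since `x'` is the sole bottom vertex in their block.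
-/
theorem not_containsPerm_gamma {x y : X} (h : x ≠ y) : ¬ ContainsPerm (gamma x y h) := by
  rintro ⟨g, hg⟩
  have key : ∀ z : X, z = x ∨ z = y → g z = x := by
    intro z hz
    have := (lab_gamma h _ _).1 (hg (some z))
    rcases hz with rfl | rfl <;> simp [move_apply, h] at this <;> grind
  exact h (g.injective ((key x (Or.inl rfl)).trans (key y (Or.inr rfl)).symm))

/-- The `n` top vertices other than `y` lie in distinct blocks. -/
theorem not_blocksLE_gamma [Fintype X] {x y : X} (h : x ≠ y) :
    ¬ BlocksLE (Fintype.card X - 1) (gamma x y h) := by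
  rintro ⟨A, hA, hu⟩
  have hsub : Finset.univ.erase (some y) ⊆
      A.image (Sum.elim (move y (some x)) (move y none)) := by
    intro z hz
    obtain ⟨a, ha, haz⟩ := hu (Sum.inl z)
    refine Finset.mem_image.2 ⟨a, ha, ((lab_gamma h _ _).1 haz).trans ?_⟩
    simp [move_apply, Finset.ne_of_mem_erase hz]
  have := (Finset.card_le_card hsub).trans Finset.card_image_le
  rw [Finset.card_erase_of_mem (by simp)] at this
  have hpos : 0 < Fintype.card X := Fintype.card_pos_iff.2 ⟨x⟩
  simp at this
  omega

/-- An element with a point in the top row, with at least `|X|` blocks, and that contains no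
permutation, lies in the double coset of the inverse of `γ_{x,y}`. -/
theorem exists_eq_perm_mul_inv_gamma_mul_perm [Fintype X] {x y : X} (hxy : x ≠ y) {u : PIStar X}
    {z : X} (hz : u.bar.rel (Sum.inl none) (Sum.inl (some z)))
    (hb : ¬ BlocksLE (Fintype.card X - 1) u) (hp : ¬ ContainsPerm u) :
    ∃ g h : Equiv.Perm X, u = ofPerm g * (gamma x y hxy)⁻¹ * ofPerm h := by
  obtain ⟨b, a, hab, hr⟩ : ∃ (b : X) (a : Option X), a ≠ some b ∧
      u.bar.rel (Sum.inr a) (Sum.inr (some b)) := by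
    have : ∃ c d : Option X, c ≠ d ∧ u.bar.rel (Sum.inr c) (Sum.inr d) := by
      -- If no bottom vertices coincide, choosing top partners is injective, hence surjective; the
      -- partners of `none` and `some z` then give a coinciding bottom pair.
      by_contra! hinj
      choose f hf using fun w : Option X => u.bar.exists_inl (Sum.inr w)
      have hfi : f.Injective := fun c d hcd => by
        by_contra hne
        refine hinj c d hne (Setoid.trans' _ (Setoid.symm' _ (hf c)) ?_)
        rw [hcd]
        exact hf d
      have hfs := Finite.injective_iff_surjective.1 hfi
      obtain ⟨c, hc⟩ := hfs none
      obtain ⟨d, hd⟩ := hfs (some z)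
      have hcd : c ≠ d := by
        rintro rfl
        simp [hc] at hd
      refine hinj c d hcd (Setoid.trans' _ (Setoid.symm' _ (hf c)) (Setoid.trans' _ ?_ (hf d)))
      rwa [hc, hd]
    obtain ⟨c, d, hcd, h⟩ := this
    cases d with
    | some d => exact ⟨d, c, hcd, h⟩
    | none =>
      obtain ⟨c, rfl⟩ := Option.ne_none_iff_exists'.1 hcd
      exact ⟨c, none, hcd.symm, Setoid.symm' _ h⟩
  have hsec : ∀ v : Option X, ∃ w, w ≠ some b ∧ u.bar.rel (Sum.inl v) (Sum.inr w) := by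
    intro v
    obtain ⟨w, hw⟩ := u.bar.exists_inr (Sum.inl v)
    by_cases h : w = some b
    · exact ⟨a, hab, Setoid.symm' _ (Setoid.trans' _ hr (h ▸ hw))⟩
    · exact ⟨w, h, Setoid.symm' _ hw⟩
  choose r hrb hr' using hsec
  have hri : ∀ v w, r v = r w ↔ u.bar.rel (Sum.inl v) (Sum.inl w) := by
    intro v w
    constructor
    · intro h
      exact Setoid.trans' _ (hr' v) (h ▸ Setoid.symm' _ (hr' w))
    · intro h
      exact eq_of_rel_inr hb hab hr (hrb v) (hrb w)
        (Setoid.trans' _ (Setoid.symm' _ (hr' v)) (Setoid.trans' _ h (hr' w)))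
  have hr0 : r none = none := eq_of_rel_inr hb hab hr (hrb none) (by simp)
    (Setoid.trans' _ (Setoid.symm' _ (hr' none)) u.bar_none)
  -- The only top coincidence is `none` with `some z`, and `r` misses only `some b`; sending `z` to
  -- `b` therefore repairs `r` to a permutation.
  obtain ⟨s, hs⟩ := exists_perm_map_eq (s := fun v => if v = some z then some b else r v)
    (by
      intro v w h
      by_cases hv : v = some z <;> by_cases hw : w = some z
      · rw [hv, hw]
      · simp only [hv, hw, if_true, if_false] at h
        exact absurd h.symm (hrb w)
      · simp only [hv, hw, if_true, if_false] at h
        exact absurd h (hrb v)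
      · simp only [hv, hw, if_false] at h
        exact eq_of_rel_inl hb (by simp) hz hv hw ((hri v w).1 h))
    (by simpa using hr0)
  have hsz : Option.map s (some z) = some b := (congrFun hs _).trans (if_pos rfl)
  have hsv : ∀ v, v ≠ some z → Option.map s v = r v := fun v hv => by simp [hs, hv]
  cases a with
  | none =>
    -- Here `z` and `b'` both lie in the extra block, so all lines of `s` lie in blocks of `ū`.
    refine absurd ⟨s, fun v => ?_⟩ hp
    by_cases hv : v = some z
    · rw [hv, hsz]
      exact Setoid.trans' _ (Setoid.symm' _ hz) (Setoid.trans' _ u.bar_none hr)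
    · rw [hsv v hv]
      exact hr' v
  | some a =>
    obtain ⟨g, hga, hgb⟩ := exists_perm_apply_eq (fun h => hab (congrArg some h)) hxy
    refine ⟨s.trans g, g.symm, Lab.perm_mul_perm (h := g) (lab_gamma hxy).inv ?_⟩
    have hmr : ∀ v, move y (some x) (Option.map g (r v)) = Option.map g (r v) := by
      intro v
      have : Option.map g (r v) ≠ some y := by
        rw [← hgb, ← Option.map_some]
        exact fun h => hrb v (map_perm_injective g h)
      simp [move_apply, this]
    -- Each vertex is traced to a top vertex of its block, where the `γ⁻¹` label becomes `g` applied
    -- to `r`; since `r` separates exactly the blocks, the labelling describes `u`.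
    have hψ : ∀ e, ∃ v, u.bar.rel e (Sum.inl v) ∧
        Sum.elim (move y none ∘ Option.map (s.trans g)) (move y (some x) ∘ Option.map g) e =
          Option.map g (r v) := by
      rintro (v | w)
      · refine ⟨v, Setoid.refl' _ _, ?_⟩
        change move y none (Option.map (g ∘ s) v) = _
        rw [← Option.map_map]
        by_cases hv : v = some z
        · rw [hv, hsz, ← (hri none (some z)).2 hz, hr0]
          simp [move_apply, hgb]
        · have := hmr v
          rw [hsv v hv]
          grind [move_apply]
      · by_cases hw : w = some b
        · obtain ⟨v, hv⟩ := u.bar.exists_inl (Sum.inr (some a))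
          refine ⟨v, hw ▸ Setoid.symm' _ (Setoid.trans' _ hv hr), ?_⟩
          have : r v = some a := eq_of_rel_inr hb hab hr (hrb v) hab
            (Setoid.trans' _ (Setoid.symm' _ (hr' v)) hv)
          simp [this, hw, move_apply, hgb, hga]
        · obtain ⟨v, hv⟩ := u.bar.exists_inl (Sum.inr w)
          have : r v = w := eq_of_rel_inr hb hab hr (hrb v) hw
            (Setoid.trans' _ (Setoid.symm' _ (hr' v)) hv)
          refine ⟨v, Setoid.symm' _ hv, ?_⟩
          rw [← hmr v, this]
          rfl
    intro d e
    obtain ⟨v, hv, hv'⟩ := hψ d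
    obtain ⟨w, hw, hw'⟩ := hψ e
    rw [hv', hw', (map_perm_injective g).eq_iff, hri]
    exact ⟨fun h => Setoid.trans' _ (Setoid.symm' _ hv) (Setoid.trans' _ h hw),
      fun h => Setoid.trans' _ hv (Setoid.trans' _ h (Setoid.symm' _ hw))⟩

/-! ### The two directions of the characterisation -/

theorem mem_of_generates [Fintype X] {x y : X} (hxy : x ≠ y) {u : PIStar X}
    (hu : GeneratesAsInverseSemigroup (symm X ∪ {u})) :
    u ∈ symm X * ({gamma x y hxy, (gamma x y hxy)⁻¹} : Set (PIStar X)) * symm X := by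
  have hN : u ∉ noPoints X := by
    intro h
    have := hu (noPoints X) (fun _ => inv_mem_noPoints) (by
      rintro _ (⟨g, rfl⟩ | rfl)
      · exact ofPerm_mem_noPoints g
      · exact h)
    exact gamma_notMem_noPoints hxy (this ▸ Subsemigroup.mem_top _)
  have hP : ¬ (ContainsPerm u ∨ BlocksLE (Fintype.card X - 1) u) := by
    intro h
    have := hu (permOrBlocksLE X (Fintype.card X - 1))
      (fun a ha => ha.imp ContainsPerm.inv BlocksLE.inv) (by
      rintro _ (⟨g, rfl⟩ | rfl)
      · exact Or.inl ⟨g, fun v => (lab_ofPerm g _ _).2 rfl⟩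
      · exact h)
    have hm : gamma x y hxy ∈ permOrBlocksLE X (Fintype.card X - 1) := this ▸ Subsemigroup.mem_top _
    exact hm.elim (not_containsPerm_gamma hxy) (not_blocksLE_gamma hxy)
  obtain ⟨hp, hb⟩ := not_or.1 hP
  have hpoint : (∃ z, u.bar.rel (Sum.inl none) (Sum.inl (some z))) ∨
      ∃ z, u.bar.rel (Sum.inr none) (Sum.inr (some z)) := by
    -- Without points in either row the extra block is just `x̄, x̄'`, contradicting `hN`.
    by_contra! hne
    have key : ∀ a b, u.bar.rel a b → Sum.elim Option.isSome Option.isSome a = false →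
        Sum.elim Option.isSome Option.isSome b = false := by
      have h0 : ∀ b, u.bar.rel (Sum.inl none) b →
          Sum.elim Option.isSome Option.isSome b = false := by
        rintro ((_ | z) | (_ | z)) h
        · rfl
        · exact absurd h (hne.1 z)
        · rfl
        · exact absurd (Setoid.trans' _ (Setoid.symm' _ u.bar_none) h) (hne.2 z)
      rintro ((_ | z) | (_ | z)) b h ha
      · exact h0 b h
      · cases ha
      · exact h0 b (Setoid.trans' _ u.bar_none h)
      · cases ha
    refine hN fun a b h => ?_
    have h₁ := key a b h
    have h₂ := key b a (Setoid.symm' _ h)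
    generalize Sum.elim Option.isSome Option.isSome a = s at h₁ h₂ ⊢
    generalize Sum.elim Option.isSome Option.isSome b = t at h₁ h₂ ⊢
    revert h₁ h₂
    cases s <;> cases t <;> simp
  rcases hpoint with ⟨z, hz⟩ | ⟨z, hz⟩
  · obtain ⟨g, h, rfl⟩ := exists_eq_perm_mul_inv_gamma_mul_perm hxy hz hb hp
    exact Set.mul_mem_mul (Set.mul_mem_mul ⟨g, rfl⟩ (Or.inr rfl)) ⟨h, rfl⟩
  -- A bottom point of `u` is a top point of `u⁻¹`, and inverting the resulting factorisation
  -- exchanges `γ⁻¹` for `γ`.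
  · obtain ⟨g, h, hgh⟩ := exists_eq_perm_mul_inv_gamma_mul_perm (u := u⁻¹) hxy
      ((inv_bar_rel _ _ _).2 hz) (fun h => hb (inv_inv' u ▸ h.inv))
      (fun h => hp (inv_inv' u ▸ h.inv))
    rw [← inv_inv' u, hgh, perm_mul_mul_perm_inv, inv_inv']
    exact Set.mul_mem_mul (Set.mul_mem_mul ⟨_, rfl⟩ (Or.inl rfl)) ⟨_, rfl⟩

theorem generates_gamma [Fintype X] {x y : X} (hxy : x ≠ y) :
    GeneratesAsInverseSemigroup (symm X ∪ {gamma x y hxy}) := fun _ hinv hT =>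
  eq_top_of_gamma_mem hinv (Set.subset_union_left.trans hT) (hxy := hxy) (hT (Or.inr rfl))

theorem generates_of_mem [Fintype X] {x y : X} (hxy : x ≠ y) {u : PIStar X}
    (hu : u ∈ symm X * ({gamma x y hxy, (gamma x y hxy)⁻¹} : Set (PIStar X)) * symm X) :
    GeneratesAsInverseSemigroup (symm X ∪ {u}) := by
  intro T hinv hT
  have hS : symm X ⊆ T := Set.subset_union_left.trans hT
  have huT : u ∈ T := hT (Or.inr rfl)
  obtain ⟨_, ⟨_, ⟨g, rfl⟩, v, hv, rfl⟩, _, ⟨h, rfl⟩, rfl⟩ := hu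
  -- The permutations on both sides cancel inside `T`, leaving `γ` or `γ⁻¹` there.
  have hvT : v ∈ T := by
    rw [← perm_mul_mul_perm_cancel g h v]
    exact T.mul_mem (T.mul_mem (hS ⟨_, rfl⟩) huT) (hS ⟨_, rfl⟩)
  refine eq_top_of_gamma_mem hinv hS (hxy := hxy) ?_
  rcases hv with rfl | rfl
  · exact hvT
  · exact inv_inv' (gamma x y hxy) ▸ hinv _ hvT

end PIStar

theorem mainTheorem6 (n : ℕ) (hn : 3 ≤ n)
    (γ : PIStar (Fin n))
    (hγ : γ = PIStar.gamma ⟨0, by omega⟩ ⟨1, by omega⟩ (Fin.ne_of_val_ne Nat.zero_ne_one)) :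
    GeneratesAsInverseSemigroup (PIStar.symm (Fin n) ∪ {γ}) ∧
    ∀ u : PIStar (Fin n), u ∉ PIStar.symm (Fin n) →
      (GeneratesAsInverseSemigroup (PIStar.symm (Fin n) ∪ {u}) ↔
        u ∈ PIStar.symm (Fin n) * ({γ, γ⁻¹} : Set (PIStar (Fin n))) * PIStar.symm (Fin n)) := by
  subst hγ
  exact ⟨PIStar.generates_gamma _, fun u _ =>
    ⟨PIStar.mem_of_generates _, PIStar.generates_of_mem _⟩⟩
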